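/- Let $K$ be a field of characteristic zero. A pre-Lie algebra over $K$ is a vector space with a bilinear product $*$ satisfying $(x*y)*z-x*(y*z)=(x*z)*y-x*(z*y)$ for all $x,y,z$; a $ComMag$-algebra is a vector space with a commutative (not necessarily associative) bilinear product. Let $preLie$ and $ComMag$ be the symmetric operads over $K$ encoding these two types of algebras: for a finite set $S$, $preLie[S]$ (resp. $ComMag[S]$) is the multilinear part of the free pre-Lie (resp. $ComMag$-) algebra on $S$, that is, the span of the monomials in which each element of $S$ occurs exactly once, and composition is substitution. Let $\Phi\colon ComMag\to preLie$ be the morphism of operads induced by the symmetrized product $x\# y:=x*y+y*x$. Then $\Phi$ sends the commutative generating operation $x\cdot y$ to $x*y+y*x$, and $\Phi$ is injective: for every finite set $S$ the linear map $\Phi_S\colon ComMag[S]\to preLie[S]$ is injective. Likewise, the symmetrized product in a free pre-Lie algebra satisfies no universal relation beyond commutativity: for every set $X$, the linear map from the free $ComMag$-algebra on $X$ to the free pre-Lie algebra on $X$ that fixes the elements of $X$ and sends each product $a\cdot b$ to the symmetrized product $\#$ of the images of $a$ and $b$ is injective. -/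

import Mathlib

universe u v w

namespace PreLieSym

/-! ### Algebraic operads

Symmetric operads in vector spaces: a functor from finite sets and bijections to vector spaces,
with a unit and a composition `O[S] ⊗ ⨂_{s ∈ S} O[T_s] → O[∐_{s ∈ S} T_s]`. -/

/-- An algebraic (symmetric) operad over `K`. -/
structure Operad (K : Type u) [Field K] where
  /-- The space of operations whose inputs are labelled by the finite set `S`. -/
  obj : (S : Type) → [Finite S] → Type v
  [addCommGroup : ∀ (S : Type) [Finite S], AddCommGroup (obj S)]
  [module : ∀ (S : Type) [Finite S], Module K (obj S)]
  /-- Relabelling of the inputs along a bijection. -/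
  map : ∀ {S T : Type} [Finite S] [Finite T], (S ≃ T) → (obj S →ₗ[K] obj T)
  /-- The identity operation. -/
  one : obj Unit
  /-- Simultaneous composition: the output of `y s` is plugged into the input `s` of `x`. -/
  comp : ∀ {S : Type} [Finite S] {T : S → Type} [∀ s, Finite (T s)],
    obj S →ₗ[K] MultilinearMap K (fun s => obj (T s)) (obj (Σ s, T s))
  map_refl : ∀ {S : Type} [Finite S] (x : obj S), map (Equiv.refl S) x = x
  map_trans : ∀ {S T U : Type} [Finite S] [Finite T] [Finite U] (e : S ≃ T) (f : T ≃ U)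
    (x : obj S), map (e.trans f) x = map f (map e x)
  comp_map_left : ∀ {S S' : Type} [Finite S] [Finite S'] {T : S' → Type} [∀ s, Finite (T s)]
    (e : S ≃ S') (x : obj S) (y : ∀ s, obj (T s)),
    comp (map e x) y = map (Equiv.sigmaCongrLeft e) (comp x (fun s => y (e s)))
  comp_map_right : ∀ {S : Type} [Finite S] {T T' : S → Type} [∀ s, Finite (T s)]
    [∀ s, Finite (T' s)] (f : ∀ s, T s ≃ T' s) (x : obj S) (y : ∀ s, obj (T s)),
    comp x (fun s => map (f s) (y s)) = map (Equiv.sigmaCongrRight f) (comp x y)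
  one_comp : ∀ {T : Unit → Type} [∀ s, Finite (T s)] (y : ∀ s, obj (T s)),
    map (Equiv.uniqueSigma T) (comp one y) = y default
  comp_one : ∀ {S : Type} [Finite S] (x : obj S),
    map (Equiv.sigmaUnique S (fun _ => Unit)) (comp x (fun _ => one)) = x
  assoc : ∀ {S : Type} [Finite S] {T : S → Type} [∀ s, Finite (T s)]
    {U : ∀ s, T s → Type} [∀ s t, Finite (U s t)]
    (x : obj S) (y : ∀ s, obj (T s)) (z : ∀ s t, obj (U s t)),
    map (Equiv.sigmaAssoc U) (comp (comp x y) (fun p : (Σ s, T s) => z p.1 p.2)) =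
      comp x (fun s => comp (y s) (z s))

attribute [instance] Operad.addCommGroup Operad.module

/-- A morphism of operads. -/
structure Operad.Hom {K : Type u} [Field K] (P : Operad.{u, v} K) (Q : Operad.{u, w} K) where
  /-- The component at the finite set `S`. -/
  app : (S : Type) → [Finite S] → (P.obj S →ₗ[K] Q.obj S)
  app_map : ∀ {S T : Type} [Finite S] [Finite T] (e : S ≃ T) (x : P.obj S),
    app T (P.map e x) = Q.map e (app S x)
  app_one : app Unit P.one = Q.one
  app_comp : ∀ {S : Type} [Finite S] {T : S → Type} [∀ s, Finite (T s)]
    (x : P.obj S) (y : ∀ s, P.obj (T s)),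
    app (Σ s, T s) (P.comp x y) = Q.comp (app S x) (fun s => app (T s) (y s))

/-! ### Types of algebras with one binary operation, and their free algebras -/

section Free

variable {K : Type u} [Field K]

/-- The algebra `A` satisfies the identities `I`, which are nonassociative polynomials in the
variables indexed by `ℕ`. -/
def Satisfies (I : Set (FreeNonUnitalNonAssocAlgebra K ℕ)) (A : Type w)
    [NonUnitalNonAssocRing A] [Module K A] [IsScalarTower K A A] [SMulCommClass K A A] : Prop :=
  ∀ p ∈ I, ∀ f : ℕ → A, FreeNonUnitalNonAssocAlgebra.lift K f p = 0

/-- Membership in the two-sided ideal generated by all substitution instances of `I`. -/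
inductive InIdeal (I : Set (FreeNonUnitalNonAssocAlgebra K ℕ)) (X : Type v) :
    FreeNonUnitalNonAssocAlgebra K X → Prop
  | inst (p : FreeNonUnitalNonAssocAlgebra K ℕ) (hp : p ∈ I)
      (f : ℕ → FreeNonUnitalNonAssocAlgebra K X) :
      InIdeal I X (FreeNonUnitalNonAssocAlgebra.lift K f p)
  | zero : InIdeal I X 0
  | add {a b : FreeNonUnitalNonAssocAlgebra K X} :
      InIdeal I X a → InIdeal I X b → InIdeal I X (a + b)
  | smul (k : K) {a : FreeNonUnitalNonAssocAlgebra K X} : InIdeal I X a → InIdeal I X (k • a)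
  | mul_left (b : FreeNonUnitalNonAssocAlgebra K X) {a : FreeNonUnitalNonAssocAlgebra K X} :
      InIdeal I X a → InIdeal I X (b * a)
  | mul_right (b : FreeNonUnitalNonAssocAlgebra K X) {a : FreeNonUnitalNonAssocAlgebra K X} :
      InIdeal I X a → InIdeal I X (a * b)

/-- The two-sided ideal generated by all substitution instances of `I`. -/
def ideal (I : Set (FreeNonUnitalNonAssocAlgebra K ℕ)) (X : Type v) :
    Submodule K (FreeNonUnitalNonAssocAlgebra K X) where
  carrier := {a | InIdeal I X a}
  add_mem' := InIdeal.add
  zero_mem' := InIdeal.zero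
  smul_mem' k _ := InIdeal.smul k

/-- The free algebra on `X` of the type of algebras defined by the identities `I`. -/
def FreeAlg (I : Set (FreeNonUnitalNonAssocAlgebra K ℕ)) (X : Type v) : Type (max u v) :=
  FreeNonUnitalNonAssocAlgebra K X ⧸ ideal I X

namespace FreeAlg

variable (I : Set (FreeNonUnitalNonAssocAlgebra K ℕ)) (X : Type v)

noncomputable instance instAddCommGroup : AddCommGroup (FreeAlg I X) :=
  inferInstanceAs (AddCommGroup (FreeNonUnitalNonAssocAlgebra K X ⧸ ideal I X))

noncomputable instance : Module K (FreeAlg I X) :=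
  inferInstanceAs (Module K (FreeNonUnitalNonAssocAlgebra K X ⧸ ideal I X))

/-- The quotient map. -/
noncomputable def mk : FreeNonUnitalNonAssocAlgebra K X →ₗ[K] FreeAlg I X := (ideal I X).mkQ

theorem mk_surjective : Function.Surjective (mk I X) := (ideal I X).mkQ_surjective

theorem mk_eq_zero {a : FreeNonUnitalNonAssocAlgebra K X} :
    mk I X a = 0 ↔ InIdeal I X a :=
  Submodule.Quotient.mk_eq_zero (ideal I X)

theorem mk_eq_mk {a b : FreeNonUnitalNonAssocAlgebra K X} :
    mk I X a = mk I X b ↔ InIdeal I X (a - b) := by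
  rw [← mk_eq_zero, map_sub, sub_eq_zero]

noncomputable instance instMul : Mul (FreeAlg I X) where
  mul := Quotient.map₂ (· * ·) (by
    intro a a' ha b b' hb
    have ha' : InIdeal I X (a - a') := (Submodule.quotientRel_def _).1 ha
    have hb' : InIdeal I X (b - b') := (Submodule.quotientRel_def _).1 hb
    refine (Submodule.quotientRel_def (ideal I X)).2 ?_
    have h : a * b - a' * b' = (a - a') * b + a' * (b - b') := by
      rw [sub_mul, mul_sub]; abel
    change InIdeal I X (a * b - a' * b')
    rw [h]
    exact (ha'.mul_right b).add (hb'.mul_left a'))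

theorem mk_mul (a b : FreeNonUnitalNonAssocAlgebra K X) :
    mk I X (a * b) = mk I X a * mk I X b := rfl

noncomputable instance : NonUnitalNonAssocRing (FreeAlg I X) where
  __ := instAddCommGroup I X
  __ := instMul I X
  left_distrib a b c := by
    obtain ⟨a, rfl⟩ := mk_surjective I X a
    obtain ⟨b, rfl⟩ := mk_surjective I X b
    obtain ⟨c, rfl⟩ := mk_surjective I X c
    rw [← map_add, ← mk_mul, ← mk_mul, ← mk_mul, mul_add, map_add]
  right_distrib a b c := by
    obtain ⟨a, rfl⟩ := mk_surjective I X a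
    obtain ⟨b, rfl⟩ := mk_surjective I X b
    obtain ⟨c, rfl⟩ := mk_surjective I X c
    rw [← map_add, ← mk_mul, ← mk_mul, ← mk_mul, add_mul, map_add]
  zero_mul a := by
    obtain ⟨a, rfl⟩ := mk_surjective I X a
    rw [← map_zero (mk I X), ← mk_mul, zero_mul]
  mul_zero a := by
    obtain ⟨a, rfl⟩ := mk_surjective I X a
    rw [← map_zero (mk I X), ← mk_mul, mul_zero]

instance : IsScalarTower K (FreeAlg I X) (FreeAlg I X) where
  smul_assoc k a b := by
    obtain ⟨a, rfl⟩ := mk_surjective I X a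
    obtain ⟨b, rfl⟩ := mk_surjective I X b
    simp only [smul_eq_mul]
    rw [← map_smul, ← mk_mul, ← mk_mul, smul_mul_assoc, map_smul]

instance : SMulCommClass K (FreeAlg I X) (FreeAlg I X) where
  smul_comm k a b := by
    obtain ⟨a, rfl⟩ := mk_surjective I X a
    obtain ⟨b, rfl⟩ := mk_surjective I X b
    simp only [smul_eq_mul]
    rw [← map_smul, ← mk_mul, ← mk_mul, mul_smul_comm, map_smul]

/-- The quotient map as a morphism of algebras. -/
noncomputable def mkHom : FreeNonUnitalNonAssocAlgebra K X →ₙₐ[K] FreeAlg I X where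
  toFun := mk I X
  map_smul' k a := map_smul (mk I X) k a
  map_zero' := map_zero (mk I X)
  map_add' := map_add (mk I X)
  map_mul' := mk_mul I X

variable {X}

/-- The generators of the free algebra. -/
noncomputable def of (x : X) : FreeAlg I X := mk I X (FreeNonUnitalNonAssocAlgebra.of K x)

variable {I}

theorem hom_ext {A : Type w} [NonUnitalNonAssocRing A] [Module K A] [IsScalarTower K A A]
    [SMulCommClass K A A] {f g : FreeAlg I X →ₙₐ[K] A} (h : ∀ x, f (of I x) = g (of I x)) :
    f = g := by
  have : f.comp (mkHom I X) = g.comp (mkHom I X) := FreeNonUnitalNonAssocAlgebra.hom_ext K h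
  ext a
  obtain ⟨a, rfl⟩ := mk_surjective I X a
  exact DFunLike.congr_fun this a

variable {A : Type w} [NonUnitalNonAssocRing A] [Module K A] [IsScalarTower K A A]
  [SMulCommClass K A A]

theorem lift_eq_zero (hA : Satisfies I A) (f : X → A) {a : FreeNonUnitalNonAssocAlgebra K X}
    (ha : InIdeal I X a) : FreeNonUnitalNonAssocAlgebra.lift K f a = 0 := by
  induction ha with
  | inst p hp g =>
    have : (FreeNonUnitalNonAssocAlgebra.lift K f).comp (FreeNonUnitalNonAssocAlgebra.lift K g) =
        FreeNonUnitalNonAssocAlgebra.lift K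
          (fun n => FreeNonUnitalNonAssocAlgebra.lift K f (g n)) :=
      FreeNonUnitalNonAssocAlgebra.hom_ext K (fun n => by simp)
    exact (DFunLike.congr_fun this p).trans (hA p hp _)
  | zero => exact map_zero _
  | add _ _ h1 h2 => rw [map_add, h1, h2, add_zero]
  | smul k _ h => rw [map_smul, h, smul_zero]
  | mul_left b _ h => rw [map_mul, h, mul_zero]
  | mul_right b _ h => rw [map_mul, h, zero_mul]

/-- The universal property of the free algebra. -/
noncomputable def lift (hA : Satisfies I A) (f : X → A) : FreeAlg I X →ₙₐ[K] A where
  toFun := (ideal I X).liftQ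
    ((FreeNonUnitalNonAssocAlgebra.lift K f : FreeNonUnitalNonAssocAlgebra K X →ₙₐ[K] A) :
      FreeNonUnitalNonAssocAlgebra K X →ₗ[K] A) (fun _ ha => lift_eq_zero hA f ha)
  map_smul' k a := map_smul _ k a
  map_zero' := map_zero _
  map_add' := map_add _
  map_mul' a b := by
    obtain ⟨a, rfl⟩ := mk_surjective I X a
    obtain ⟨b, rfl⟩ := mk_surjective I X b
    exact map_mul (FreeNonUnitalNonAssocAlgebra.lift K f) a b

@[simp]
theorem lift_of (hA : Satisfies I A) (f : X → A) (x : X) : lift hA f (of I x) = f x :=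
  FreeNonUnitalNonAssocAlgebra.lift_of_apply K f x

variable (I X)

theorem satisfies : Satisfies I (FreeAlg I X) := by
  intro p hp f
  choose g hg using fun n => mk_surjective I X (f n)
  have : (mkHom I X).comp (FreeNonUnitalNonAssocAlgebra.lift K g) =
      FreeNonUnitalNonAssocAlgebra.lift K f :=
    FreeNonUnitalNonAssocAlgebra.hom_ext K (fun n => by simpa [mkHom] using hg n)
  rw [← this]
  exact (mk_eq_zero I X).2 (InIdeal.inst p hp g)

end FreeAlg

end Free

/-! ### The operad of a type of algebras: multilinear parts of the free algebras -/

section OperadOf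

/-- The list of the leaves of a nonassociative monomial. -/
def leaves {X : Type v} : FreeMagma X → List X
  | FreeMagma.of x => [x]
  | FreeMagma.mul m n => leaves m ++ leaves n

@[simp]
theorem leaves_of {X : Type v} (x : X) : leaves (FreeMagma.of x) = [x] := rfl

@[simp]
theorem leaves_mul {X : Type v} (m n : FreeMagma X) : leaves (m * n) = leaves m ++ leaves n := rfl

variable {K : Type u} [Field K]

/-- The class of a monomial in a free algebra. -/
noncomputable def mon (I : Set (FreeNonUnitalNonAssocAlgebra K ℕ)) {X : Type v} (m : FreeMagma X) :
    FreeAlg I X :=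
  FreeMagma.lift (FreeAlg.of I) m

@[simp]
theorem mon_of (I : Set (FreeNonUnitalNonAssocAlgebra K ℕ)) {X : Type v} (x : X) :
    mon I (FreeMagma.of x) = FreeAlg.of I x := rfl

@[simp]
theorem mon_mul (I : Set (FreeNonUnitalNonAssocAlgebra K ℕ)) {X : Type v} (m n : FreeMagma X) :
    mon I (m * n) = mon I m * mon I n := rfl

/-- The span of the monomials without repeated generators, whose generators are exactly the
elements of `s`. -/
noncomputable def multilinearOn (I : Set (FreeNonUnitalNonAssocAlgebra K ℕ)) {X : Type v} (s : Set X) :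
    Submodule K (FreeAlg I X) :=
  Submodule.span K (mon I '' {m | (leaves m).Nodup ∧ ∀ x, x ∈ leaves m ↔ x ∈ s})

theorem mul_mem_multilinearOn {I : Set (FreeNonUnitalNonAssocAlgebra K ℕ)} {X : Type v}
    {s t : Set X} (hst : Disjoint s t) {a b : FreeAlg I X} (ha : a ∈ multilinearOn I s)
    (hb : b ∈ multilinearOn I t) : a * b ∈ multilinearOn I (s ∪ t) := by
  induction ha using Submodule.span_induction with
  | mem a ha =>
    obtain ⟨m, ⟨hm, hms⟩, rfl⟩ := ha
    induction hb using Submodule.span_induction with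
    | mem b hb =>
      obtain ⟨n, ⟨hn, hnt⟩, rfl⟩ := hb
      refine Submodule.subset_span ⟨m * n, ⟨?_, ?_⟩, rfl⟩
      · rw [leaves_mul, List.nodup_append']
        exact ⟨hm, hn, fun x hx hx' => Set.disjoint_left.1 hst ((hms x).1 hx) ((hnt x).1 hx')⟩
      · intro x
        rw [leaves_mul, List.mem_append, hms, hnt, Set.mem_union]
    | zero => rw [mul_zero]; exact zero_mem _
    | add b c _ _ hb hc => rw [mul_add]; exact add_mem hb hc
    | smul k b _ hb => rw [mul_smul_comm]; exact Submodule.smul_mem _ k hb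
  | zero => rw [zero_mul]; exact zero_mem _
  | add a c _ _ ha hc => rw [add_mul]; exact add_mem ha hc
  | smul k a _ ha => rw [smul_mul_assoc]; exact Submodule.smul_mem _ k ha

/-- The multilinear part of the free algebra on `S`: the span of the monomials in which every
element of `S` occurs exactly once. -/
noncomputable def multilinear (I : Set (FreeNonUnitalNonAssocAlgebra K ℕ)) (S : Type v) :
    Submodule K (FreeAlg I S) :=
  multilinearOn I Set.univ

variable (I : Set (FreeNonUnitalNonAssocAlgebra K ℕ))

/-- Substitution of elements of a free algebra for the generators. -/
noncomputable def subst {X : Type v} {Y : Type w} (f : X → FreeAlg I Y) :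
    FreeAlg I X →ₙₐ[K] FreeAlg I Y :=
  FreeAlg.lift (FreeAlg.satisfies I Y) f

@[simp]
theorem subst_of {X : Type v} {Y : Type w} (f : X → FreeAlg I Y) (x : X) :
    subst I f (FreeAlg.of I x) = f x :=
  FreeAlg.lift_of _ f x

/-- Relabelling of the generators of a free algebra. -/
noncomputable def relabel {X : Type v} {Y : Type w} (f : X → Y) : FreeAlg I X →ₙₐ[K] FreeAlg I Y :=
  subst I (fun x => FreeAlg.of I (f x))

@[simp]
theorem relabel_of {X : Type v} {Y : Type w} (f : X → Y) (x : X) :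
    relabel I f (FreeAlg.of I x) = FreeAlg.of I (f x) :=
  subst_of I _ x

variable {I}

theorem subst_mon_mem {X : Type v} {Y : Type w} {f : X → FreeAlg I Y} {t : X → Set Y}
    (ht : Pairwise fun x x' => Disjoint (t x) (t x')) (hf : ∀ x, f x ∈ multilinearOn I (t x))
    (m : FreeMagma X) (hm : (leaves m).Nodup) :
    subst I f (mon I m) ∈ multilinearOn I {y | ∃ x ∈ leaves m, y ∈ t x} := by
  induction m with
  | ih1 x => simpa using hf x
  | ih2 m n ihm ihn =>
    rw [leaves_mul, List.nodup_append'] at hm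
    have hd : Disjoint {y | ∃ x ∈ leaves m, y ∈ t x} {y | ∃ x ∈ leaves n, y ∈ t x} := by
      rw [Set.disjoint_left]
      rintro y ⟨x, hx, hy⟩ ⟨x', hx', hy'⟩
      have hne : x ≠ x' := by
        rintro rfl
        exact hm.2.2 hx hx'
      exact Set.disjoint_left.1 (ht hne) hy hy'
    have := mul_mem_multilinearOn hd (ihm hm.1) (ihn hm.2.1)
    rw [mon_mul, map_mul]
    convert this using 2
    ext y
    simp only [leaves_mul, List.mem_append, Set.mem_ofPred_eq, Set.mem_union]
    constructor
    · rintro ⟨x, hx | hx, hy⟩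
      · exact Or.inl ⟨x, hx, hy⟩
      · exact Or.inr ⟨x, hx, hy⟩
    · rintro (⟨x, hx, hy⟩ | ⟨x, hx, hy⟩)
      · exact ⟨x, Or.inl hx, hy⟩
      · exact ⟨x, Or.inr hx, hy⟩

theorem subst_mem {X : Type v} {Y : Type w} {f : X → FreeAlg I Y} {t : X → Set Y}
    (ht : Pairwise fun x x' => Disjoint (t x) (t x')) (htop : ∀ y, ∃ x, y ∈ t x)
    (hf : ∀ x, f x ∈ multilinearOn I (t x)) {a : FreeAlg I X} (ha : a ∈ multilinear I X) :
    subst I f a ∈ multilinear I Y := by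
  induction ha using Submodule.span_induction with
  | mem a ha =>
    obtain ⟨m, ⟨hm, hms⟩, rfl⟩ := ha
    have := subst_mon_mem ht hf m hm
    convert this using 1
    unfold multilinear
    congr 1
    ext y
    obtain ⟨x, hx⟩ := htop y
    simp only [Set.mem_univ, Set.mem_ofPred_eq, true_iff]
    exact ⟨x, (hms x).2 trivial, hx⟩
  | zero => rw [map_zero]; exact zero_mem _
  | add a c _ _ ha hc => rw [map_add]; exact add_mem ha hc
  | smul k a _ ha => rw [map_smul]; exact Submodule.smul_mem _ k ha

theorem of_mem_multilinearOn {X : Type v} (x : X) :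
    FreeAlg.of I x ∈ multilinearOn I {x} :=
  Submodule.subset_span ⟨FreeMagma.of x, by simp, rfl⟩

theorem relabel_mem_multilinearOn {X : Type v} {Y : Type w} {f : X → Y}
    (hf : Function.Injective f) {a : FreeAlg I X} (ha : a ∈ multilinear I X) :
    relabel I f a ∈ multilinearOn I (Set.range f) := by
  induction ha using Submodule.span_induction with
  | mem a ha =>
    obtain ⟨m, ⟨hm, hms⟩, rfl⟩ := ha
    have := subst_mon_mem (I := I) (f := fun x => FreeAlg.of I (f x)) (t := fun x => {f x})
      (fun x x' hne => by simpa using fun h => hne (hf h))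
      (fun x => of_mem_multilinearOn (f x)) m hm
    change subst I (fun x => FreeAlg.of I (f x)) (mon I m) ∈ _
    convert this using 2
    ext y
    simp only [Set.mem_range, Set.mem_singleton_iff, Set.mem_ofPred_eq]
    constructor
    · rintro ⟨x, rfl⟩
      exact ⟨x, (hms x).2 trivial, rfl⟩
    · rintro ⟨x, _, rfl⟩
      exact ⟨x, rfl⟩
  | zero => rw [map_zero]; exact zero_mem _
  | add a c _ _ ha hc => rw [map_add]; exact add_mem ha hc
  | smul k a _ ha => rw [map_smul]; exact Submodule.smul_mem _ k ha

theorem relabel_mem {X : Type v} {Y : Type w} (e : X ≃ Y) {a : FreeAlg I X}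
    (ha : a ∈ multilinear I X) : relabel I e a ∈ multilinear I Y := by
  have := relabel_mem_multilinearOn e.injective ha
  rwa [e.surjective.range_eq] at this

/-- The substitution that plugs `y s` into the generator `s`, the labels of the various `y s` being
made disjoint. -/
noncomputable def plug {S : Type v} {T : S → Type w} (y : ∀ s, FreeAlg I (T s)) :
    FreeAlg I S →ₙₐ[K] FreeAlg I (Σ s, T s) :=
  subst I (fun s => relabel I (Sigma.mk s) (y s))

@[simp]
theorem plug_of {S : Type v} {T : S → Type w} (y : ∀ s, FreeAlg I (T s)) (s : S) :
    plug y (FreeAlg.of I s) = relabel I (Sigma.mk s) (y s) :=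
  subst_of I _ s

theorem plug_mem {S : Type v} {T : S → Type w} {y : ∀ s, FreeAlg I (T s)}
    (hy : ∀ s, y s ∈ multilinear I (T s)) {x : FreeAlg I S} (hx : x ∈ multilinear I S) :
    plug y x ∈ multilinear I (Σ s, T s) := by
  refine subst_mem (t := fun s => Set.range (Sigma.mk s)) ?_ ?_ ?_ hx
  · intro s s' hne
    rw [Set.disjoint_left]
    rintro _ ⟨a, rfl⟩ ⟨b, hb⟩
    exact hne (congrArg Sigma.fst hb).symm
  · rintro ⟨s, a⟩
    exact ⟨s, a, rfl⟩
  · exact fun s => relabel_mem_multilinearOn sigma_mk_injective (hy s)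

theorem plug_mon_congr {S : Type v} {T : S → Type w} {y z : ∀ s, FreeAlg I (T s)}
    (m : FreeMagma S) (h : ∀ s ∈ leaves m, y s = z s) : plug y (mon I m) = plug z (mon I m) := by
  induction m with
  | ih1 s => simp [h s (by simp)]
  | ih2 m n ihm ihn =>
    rw [mon_mul, map_mul, map_mul, ihm (fun s hs => h s (by simp [hs])),
      ihn (fun s hs => h s (by simp [hs]))]

theorem plug_mon_update {S : Type v} [DecidableEq S] {T : S → Type w}
    (y : ∀ s, FreeAlg I (T s)) (m : FreeMagma S) (hm : (leaves m).Nodup) (s : S)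
    (hs : s ∈ leaves m) (k l : K) (a b : FreeAlg I (T s)) :
    plug (Function.update y s (k • a + l • b)) (mon I m) =
      k • plug (Function.update y s a) (mon I m) + l • plug (Function.update y s b) (mon I m) := by
  induction m with
  | ih1 s' =>
    obtain rfl : s = s' := by simpa using hs
    simp
  | ih2 m n ihm ihn =>
    rw [leaves_mul, List.nodup_append'] at hm
    have key : ∀ (m' : FreeMagma S), s ∉ leaves m' → ∀ c d : FreeAlg I (T s),
        plug (Function.update y s c) (mon I m') = plug (Function.update y s d) (mon I m') := by
      intro m' h c d
      refine plug_mon_congr m' (fun s' hs' => ?_)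
      have : s' ≠ s := by
        rintro rfl
        exact h hs'
      rw [Function.update_of_ne this, Function.update_of_ne this]
    rw [mon_mul, map_mul, map_mul, map_mul]
    by_cases h : s ∈ leaves m
    · have hn : s ∉ leaves n := fun h' => hm.2.2 h h'
      rw [ihm hm.1 h, key n hn _ b, key n hn a b, add_mul, smul_mul_assoc, smul_mul_assoc]
    · have hn : s ∈ leaves n := (List.mem_append.1 hs).resolve_left h
      rw [ihn hm.2.1 hn, key m h _ b, key m h a b, mul_add, mul_smul_comm, mul_smul_comm]

theorem plug_update {S : Type v} [DecidableEq S] {T : S → Type w}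
    (y : ∀ s, FreeAlg I (T s)) {x : FreeAlg I S} (hx : x ∈ multilinear I S) (s : S)
    (k l : K) (a b : FreeAlg I (T s)) :
    plug (Function.update y s (k • a + l • b)) x =
      k • plug (Function.update y s a) x + l • plug (Function.update y s b) x := by
  induction hx using Submodule.span_induction with
  | mem x hx =>
    obtain ⟨m, ⟨hm, hms⟩, rfl⟩ := hx
    exact plug_mon_update y m hm s ((hms s).2 trivial) k l a b
  | zero => simp
  | add x x' _ _ hx hx' => rw [map_add, map_add, map_add, hx, hx', smul_add, smul_add]; abel
  | smul c x _ hx =>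
    rw [map_smul, map_smul, map_smul, hx, smul_add, smul_comm c k, smul_comm c l]

theorem coe_update {S : Type v} [DecidableEq S] {T : S → Type w}
    (y : ∀ s, multilinear I (T s)) (s : S) (a : multilinear I (T s)) :
    (fun s' => ((Function.update y s a s' : multilinear I (T s')) : FreeAlg I (T s'))) =
      Function.update (fun s' => (y s' : FreeAlg I (T s'))) s (a : FreeAlg I (T s)) := by
  ext s'
  by_cases h : s' = s
  · subst h
    simp
  · simp [Function.update_of_ne h]

variable (I)

/-- Relabelling on multilinear parts. -/
noncomputable def mlMap {S : Type v} {T : Type w} (e : S ≃ T) :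
    multilinear I S →ₗ[K] multilinear I T where
  toFun x := ⟨relabel I e x, relabel_mem e x.2⟩
  map_add' _ _ := Subtype.ext (map_add (relabel I e) _ _)
  map_smul' k _ := Subtype.ext (map_smul (relabel I e) k _)

/-- Substitution on multilinear parts. -/
noncomputable def mlComp {S : Type v} {T : S → Type w} :
    multilinear I S →ₗ[K]
      MultilinearMap K (fun s => multilinear I (T s)) (multilinear I (Σ s, T s)) where
  toFun x :=
    { toFun := fun y => ⟨plug (fun s => (y s : FreeAlg I (T s))) x, plug_mem (fun s => (y s).2) x.2⟩
      map_update_add' := fun y s a b => Subtype.ext (by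
        have := plug_update (fun s => (y s : FreeAlg I (T s))) x.2 s 1 1 a b
        simpa only [coe_update, one_smul, Submodule.coe_add] using this)
      map_update_smul' := fun y s k a => Subtype.ext (by
        have := plug_update (fun s => (y s : FreeAlg I (T s))) x.2 s k 0 a a
        simpa only [coe_update, zero_smul, add_zero, Submodule.coe_smul] using this) }
  map_add' x x' := by
    ext y
    exact map_add (plug (fun s => (y s : FreeAlg I (T s)))) _ _
  map_smul' k x := by
    ext y
    exact map_smul (plug (fun s => (y s : FreeAlg I (T s)))) k _

@[simp]
theorem coe_mlMap {S : Type v} {T : Type w} (e : S ≃ T) (x : multilinear I S) :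
    (mlMap I e x : FreeAlg I T) = relabel I e x := rfl

@[simp]
theorem coe_mlComp {S : Type v} {T : S → Type w} (x : multilinear I S)
    (y : ∀ s, multilinear I (T s)) :
    (mlComp I x y : FreeAlg I (Σ s, T s)) = plug (fun s => (y s : FreeAlg I (T s))) x := rfl

variable {I}

theorem relabel_relabel {X Y Z : Type*} (f : X → Y) (g : Y → Z) (a : FreeAlg I X) :
    relabel I g (relabel I f a) = relabel I (fun x => g (f x)) a :=
  DFunLike.congr_fun (f := (relabel I g).comp (relabel I f)) (FreeAlg.hom_ext fun x => by simp) a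

theorem relabel_id {X : Type*} (a : FreeAlg I X) : relabel I (fun x => x) a = a :=
  DFunLike.congr_fun (g := NonUnitalAlgHom.id K (FreeAlg I X)) (FreeAlg.hom_ext fun x => by simp) a

theorem plug_relabel {S S' : Type v} {T : S' → Type w} {f : S → S'} (x : FreeAlg I S)
    (y : ∀ s, FreeAlg I (T s)) :
    plug y (relabel I f x) =
      relabel I (fun p : (Σ s, T (f s)) => (⟨f p.1, p.2⟩ : Σ s, T s)) (plug (fun s => y (f s)) x) :=
  DFunLike.congr_fun (f := (plug y).comp (relabel I f)) (g := (relabel I _).comp (plug _))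
    (FreeAlg.hom_ext fun s => by simp [relabel_relabel]) x

theorem relabel_plug {S S' : Type*} {T : S → Type*} {T' : S' → Type*} {F : (Σ s, T s) → Σ s, T' s}
    (x : FreeAlg I S) (y : ∀ s, FreeAlg I (T s)) :
    relabel I F (plug y x) = subst I (fun s => relabel I (fun t => F ⟨s, t⟩) (y s)) x :=
  DFunLike.congr_fun (f := (relabel I F).comp (plug y))
    (FreeAlg.hom_ext fun s => by simp [relabel_relabel]) x

theorem plug_plug {S : Type*} {T : S → Type*} {U : ∀ s, T s → Type*} (x : FreeAlg I S)
    (y : ∀ s, FreeAlg I (T s)) (z : ∀ s t, FreeAlg I (U s t)) :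
    relabel I (Equiv.sigmaAssoc U) (plug (fun p : (Σ s, T s) => z p.1 p.2) (plug y x)) =
      plug (fun s => plug (z s) (y s)) x := by
  refine DFunLike.congr_fun
    (f := (relabel I (Equiv.sigmaAssoc U)).comp ((plug fun p : (Σ s, T s) => z p.1 p.2).comp (plug y)))
    (FreeAlg.hom_ext fun s => ?_) x
  simp only [NonUnitalAlgHom.comp_apply, plug_of]
  refine DFunLike.congr_fun
    (f := (relabel I (Equiv.sigmaAssoc U)).comp
      ((plug fun p : (Σ s, T s) => z p.1 p.2).comp (relabel I (Sigma.mk s))))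
    (g := (relabel I (Sigma.mk s)).comp (plug (z s)))
    (FreeAlg.hom_ext fun t => ?_) (y s)
  simp [relabel_relabel]
  rfl

variable (I)

theorem mlComp_assoc {S : Type v} {T : S → Type w} {U : ∀ s, T s → Type w} (x : multilinear I S)
    (y : ∀ s, multilinear I (T s)) (z : ∀ s t, multilinear I (U s t)) :
    mlMap I (Equiv.sigmaAssoc U) (mlComp I (mlComp I x y) (fun p : (Σ s, T s) => z p.1 p.2)) =
      mlComp I x (fun s => mlComp I (y s) (z s)) := by
  refine Subtype.ext ?_
  rw [coe_mlMap, coe_mlComp, coe_mlComp, coe_mlComp]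
  exact plug_plug (x : FreeAlg I S) (fun s => (y s : FreeAlg I (T s)))
    (fun s t => (z s t : FreeAlg I (U s t)))

/-- The operad of the type of algebras with one binary operation defined by the multilinear
identities `I`. -/
noncomputable def operadOf : Operad.{u, u} K where
  obj S _ := multilinear I S
  map e := mlMap I e
  one := ⟨FreeAlg.of I (), Submodule.subset_span ⟨FreeMagma.of (), by simp, rfl⟩⟩
  comp := mlComp I
  map_refl x := Subtype.ext (relabel_id _)
  map_trans e f x := Subtype.ext (relabel_relabel e f _).symm
  comp_map_left e x y := Subtype.ext (plug_relabel _ _)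
  comp_map_right f x y := Subtype.ext (by
    refine DFunLike.congr_fun (f := plug _) (g := (relabel I _).comp (plug _))
      (FreeAlg.hom_ext fun s => ?_) _
    simp [relabel_relabel])
  one_comp y := Subtype.ext (by
    simp only [coe_mlMap, coe_mlComp, plug_of, relabel_relabel]
    exact relabel_id _)
  comp_one x := Subtype.ext (by
    refine DFunLike.congr_fun (f := (relabel I _).comp (plug _))
      (g := NonUnitalAlgHom.id K _) (FreeAlg.hom_ext fun s => ?_) _
    simp)
  assoc x y z := mlComp_assoc I x y z

/-- The generating operation `x₀ * x₁`. -/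
noncomputable def gen : (operadOf I).obj (Fin 2) :=
  ⟨FreeAlg.of I 0 * FreeAlg.of I 1,
    Submodule.subset_span ⟨FreeMagma.of 0 * FreeMagma.of 1, ⟨by simp, by
      intro x
      fin_cases x <;> simp⟩, rfl⟩⟩

end OperadOf

/-! ### Commutative magmatic algebras and pre-Lie algebras -/

section Main

variable (K : Type u) [Field K]

/-- The variable `xₙ`. -/
noncomputable abbrev var (n : ℕ) : FreeNonUnitalNonAssocAlgebra K ℕ :=
  FreeNonUnitalNonAssocAlgebra.of K n

/-- The identity `x₀ x₁ = x₁ x₀`. -/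
def comIds : Set (FreeNonUnitalNonAssocAlgebra K ℕ) :=
  {var K 0 * var K 1 - var K 1 * var K 0}

/-- The identity `(x₀ x₁) x₂ - x₀ (x₁ x₂) = (x₀ x₂) x₁ - x₀ (x₂ x₁)`. -/
def preLieIds : Set (FreeNonUnitalNonAssocAlgebra K ℕ) :=
  {((var K 0 * var K 1) * var K 2 - var K 0 * (var K 1 * var K 2)) -
    ((var K 0 * var K 2) * var K 1 - var K 0 * (var K 2 * var K 1))}

variable {K} in
theorem satisfies_comIds_iff {A : Type w} [NonUnitalNonAssocRing A] [Module K A]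
    [IsScalarTower K A A] [SMulCommClass K A A] :
    Satisfies (comIds K) A ↔ ∀ x y : A, x * y = y * x := by
  constructor
  · intro h x y
    have := h _ rfl (fun n => if n = 0 then x else y)
    simpa [sub_eq_zero] using this
  · rintro h p rfl f
    simp [h (f 0) (f 1)]

variable {K} in
theorem satisfies_preLieIds_iff {A : Type w} [NonUnitalNonAssocRing A] [Module K A]
    [IsScalarTower K A A] [SMulCommClass K A A] :
    Satisfies (preLieIds K) A ↔ ∀ x y z : A, associator x y z = associator x z y := by
  constructor
  · intro h x y z
    have := h _ rfl (fun n => if n = 0 then x else if n = 1 then y else z)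
    simpa [sub_eq_zero, associator_apply] using this
  · rintro h p rfl f
    have := h (f 0) (f 1) (f 2)
    simpa [sub_eq_zero, associator_apply] using this

/-- The free commutative magmatic algebra on `X`. -/
abbrev FreeComMag (X : Type v) : Type (max u v) := FreeAlg (comIds K) X

/-- The free pre-Lie algebra on `X`. -/
abbrev FreePreLie (X : Type v) : Type (max u v) := FreeAlg (preLieIds K) X

noncomputable instance (X : Type v) : NonUnitalNonAssocCommRing (FreeComMag K X) where
  mul_comm := satisfies_comIds_iff.1 (FreeAlg.satisfies _ _)

noncomputable instance (X : Type v) : RightPreLieRing (FreePreLie K X) where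
  assoc_symm' := satisfies_preLieIds_iff.1 (FreeAlg.satisfies _ _)

noncomputable instance (X : Type v) : RightPreLieAlgebra K (FreePreLie K X) where

/-- The operad of algebras with one commutative binary operation. -/
noncomputable def ComMag : Operad.{u, u} K := operadOf (comIds K)

/-- The operad of pre-Lie algebras. -/
noncomputable def PreLie : Operad.{u, u} K := operadOf (preLieIds K)

/-- The commutative generating operation of `ComMag`. -/
noncomputable def comGen : (ComMag K).obj (Fin 2) := gen (comIds K)

/-- The generating operation of `PreLie`, the pre-Lie product. -/
noncomputable def preLieGen : (PreLie K).obj (Fin 2) := gen (preLieIds K)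

/-- The vector space `A` with the symmetrized product `x # y = x * y + y * x`. -/
def Symmetrized (A : Type w) : Type w := A

namespace Symmetrized

variable (A : Type w) [NonUnitalNonAssocRing A]

instance instAddCommGroup : AddCommGroup (Symmetrized A) := inferInstanceAs (AddCommGroup A)

/-- The identity map from `A` to its symmetrization. -/
def into : A ≃+ Symmetrized A := AddEquiv.refl A

instance instMul : Mul (Symmetrized A) where
  mul x y := into A ((into A).symm x * (into A).symm y + (into A).symm y * (into A).symm x)

variable {A} in
theorem mul_def (x y : Symmetrized A) :
    x * y = into A ((into A).symm x * (into A).symm y + (into A).symm y * (into A).symm x) := rfl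

instance : NonUnitalNonAssocRing (Symmetrized A) where
  __ := instAddCommGroup A
  __ := instMul A
  left_distrib x y z := by
    simp only [mul_def, map_add, mul_add, add_mul]; abel
  right_distrib x y z := by
    simp only [mul_def, map_add, mul_add, add_mul]; abel
  zero_mul x := by simp [mul_def]
  mul_zero x := by simp [mul_def]

variable {K} [Module K A]

instance instModule : Module K (Symmetrized A) := inferInstanceAs (Module K A)

variable {A} in
theorem into_symm_smul (k : K) (x : Symmetrized A) :
    (into A).symm (k • x) = k • (into A).symm x := rfl

variable {A} in
theorem into_smul (k : K) (x : A) : into A (k • x) = k • into A x := rfl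

instance [IsScalarTower K A A] [SMulCommClass K A A] :
    IsScalarTower K (Symmetrized A) (Symmetrized A) where
  smul_assoc k x y := by
    simp only [smul_eq_mul, mul_def, into_symm_smul, smul_mul_assoc, mul_smul_comm, ← smul_add,
      into_smul]

instance [IsScalarTower K A A] [SMulCommClass K A A] :
    SMulCommClass K (Symmetrized A) (Symmetrized A) where
  smul_comm k x y := by
    simp only [smul_eq_mul, mul_def, into_symm_smul, smul_mul_assoc, mul_smul_comm, ← smul_add,
      into_smul]

theorem satisfies [IsScalarTower K A A] [SMulCommClass K A A] :
    Satisfies (comIds K) (Symmetrized A) :=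
  satisfies_comIds_iff.2 fun x y => by rw [mul_def, mul_def, add_comm]

end Symmetrized

/-- The morphism of algebras from the free commutative magmatic algebra on `X` to the free pre-Lie
algebra on `X` equipped with the symmetrized product, which fixes the generators. -/
noncomputable def symHom (X : Type v) : FreeComMag K X →ₙₐ[K] Symmetrized (FreePreLie K X) :=
  FreeAlg.lift (Symmetrized.satisfies (FreePreLie K X))
    (fun x => Symmetrized.into _ (FreeAlg.of (preLieIds K) x))

/-- The linear map from the free commutative magmatic algebra on `X` to the free pre-Lie algebra
on `X` that fixes the generators and sends products to symmetrized products. -/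
noncomputable def symMap (X : Type v) : FreeComMag K X →ₗ[K] FreePreLie K X where
  toFun a := (Symmetrized.into _).symm (symHom K X a)
  map_add' a b := by rw [map_add, map_add]
  map_smul' k a := by rw [map_smul]; rfl

@[simp]
theorem symMap_of {X : Type v} (x : X) :
    symMap K X (FreeAlg.of (comIds K) x) = FreeAlg.of (preLieIds K) x :=
  FreeAlg.lift_of (Symmetrized.satisfies (FreePreLie K X))
    (fun x => Symmetrized.into _ (FreeAlg.of (preLieIds K) x)) x

@[simp]
theorem symMap_mul {X : Type v} (a b : FreeComMag K X) :
    symMap K X (a * b) = symMap K X a * symMap K X b + symMap K X b * symMap K X a :=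
  map_mul (symHom K X) a b

variable {K}

theorem symMap_mon_mem {X : Type v} (m : FreeMagma X) (hm : (leaves m).Nodup) :
    symMap K X (mon (comIds K) m) ∈ multilinearOn (preLieIds K) {x | x ∈ leaves m} := by
  induction m with
  | ih1 x => simpa using of_mem_multilinearOn x
  | ih2 m n ihm ihn =>
    rw [leaves_mul, List.nodup_append'] at hm
    have hd : Disjoint {x | x ∈ leaves m} {x | x ∈ leaves n} :=
      Set.disjoint_left.2 fun x hx hx' => hm.2.2 hx hx'
    have hu : {x | x ∈ leaves (m * n)} = {x | x ∈ leaves m} ∪ {x | x ∈ leaves n} := by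
      ext x
      simp
    rw [mon_mul, symMap_mul, hu]
    refine add_mem (mul_mem_multilinearOn hd (ihm hm.1) (ihn hm.2.1)) ?_
    rw [Set.union_comm]
    exact mul_mem_multilinearOn hd.symm (ihn hm.2.1) (ihm hm.1)

theorem symMap_mem {X : Type v} {a : FreeComMag K X} (ha : a ∈ multilinear (comIds K) X) :
    symMap K X a ∈ multilinear (preLieIds K) X := by
  induction ha using Submodule.span_induction with
  | mem a ha =>
    obtain ⟨m, ⟨hm, hms⟩, rfl⟩ := ha
    have := symMap_mon_mem (K := K) m hm
    have hu : {x | x ∈ leaves m} = Set.univ := Set.ext hms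
    rwa [hu] at this
  | zero => rw [map_zero]; exact zero_mem _
  | add a c _ _ ha hc => rw [map_add]; exact add_mem ha hc
  | smul k a _ ha => rw [map_smul]; exact Submodule.smul_mem _ k ha

/-- A morphism of algebras, between the symmetrizations. -/
def Symmetrized.mapHom {A : Type v} {B : Type w} [NonUnitalNonAssocRing A] [Module K A]
    [NonUnitalNonAssocRing B] [Module K B] (f : A →ₙₐ[K] B) :
    Symmetrized A →ₙₐ[K] Symmetrized B where
  toFun a := Symmetrized.into B (f ((Symmetrized.into A).symm a))
  map_smul' k a := map_smul f k _
  map_zero' := map_zero f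
  map_add' a b := map_add f _ _
  map_mul' a b := by
    simp only [Symmetrized.mul_def, AddEquiv.symm_apply_apply, map_add, map_mul]

theorem symMap_subst {X : Type v} {Y : Type w} (f : X → FreeComMag K Y) (a : FreeComMag K X) :
    symMap K Y (subst (comIds K) f a) =
      subst (preLieIds K) (fun x => symMap K Y (f x)) (symMap K X a) := by
  have h : (symHom K Y).comp (subst (comIds K) f) =
      (Symmetrized.mapHom (subst (preLieIds K) (fun x => symMap K Y (f x)))).comp (symHom K X) := by
    refine FreeAlg.hom_ext fun x => ?_
    rw [NonUnitalAlgHom.comp_apply, NonUnitalAlgHom.comp_apply, subst_of]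
    exact (subst_of (preLieIds K) (fun x => symMap K Y (f x)) x).symm.trans
      (congrArg _ (symMap_of K x).symm)
  exact DFunLike.congr_fun h a

theorem symMap_relabel {X : Type v} {Y : Type w} (f : X → Y) (a : FreeComMag K X) :
    symMap K Y (relabel (comIds K) f a) = relabel (preLieIds K) f (symMap K X a) := by
  simp only [relabel, symMap_subst, symMap_of]

theorem symMap_plug {S : Type v} {T : S → Type w} (y : ∀ s, FreeComMag K (T s))
    (a : FreeComMag K S) :
    symMap K (Σ s, T s) (plug y a) = plug (fun s => symMap K (T s) (y s)) (symMap K S a) := by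
  simp only [plug, symMap_subst, symMap_relabel]

variable (K)

/-- The morphism of operads `ComMag → PreLie` induced by the symmetrized product. -/
noncomputable def Phi : (ComMag K).Hom (PreLie K) where
  app S _ :=
    { toFun := fun x => ⟨symMap K S x.1, symMap_mem x.2⟩
      map_add' := fun _ _ => Subtype.ext (map_add (symMap K S) _ _)
      map_smul' := fun k _ => Subtype.ext (map_smul (symMap K S) k _) }
  app_map e x := Subtype.ext (symMap_relabel e x.1)
  app_one := Subtype.ext (symMap_of K ())
  app_comp x y := Subtype.ext (symMap_plug (fun s => (y s).1) x.1)

end Main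

end PreLieSym

/-! Injectivity on free algebras gives injectivity of every `Phi` component by restriction to
multilinear parts, so everything rests on `symMap_injective`. The idea is to recover the degree
operator `m ↦ |m| m` of the free `ComMag`-algebra from a derivation of the free pre-Lie algebra `L`;
in characteristic zero that operator has trivial kernel.

Let `T` be the space of words in a basis of `L`, let `ℓ_y` prepend `y` (`consOp`), and let `r_y`
(`insertOp`) insert `y` at every place of a word, minus the sum of the words in which one letter `x`
is replaced by `x * y`. These operators make `Hom(T, P)` a bimodule over `L`, i.e. `SplitExt` is
pre-Lie, for any vector space `P`. Hence any values on the generators extend to a derivation `D`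
from `L` to `Hom(T, P)`, and for the symmetrized product `D(x # y) = D(x) σ_y + D(y) σ_x`, where `σ
= ℓ + r` (`symOp`).

The decisive point is `symWords_injective`: the map `x₁⋯xₙ ↦ σ_{x₁}⋯σ_{xₙ} 1` is injective. One
`σ_y` is `1 + τ` after prepending `y`, where `τ` (`shuffleFirst`) inserts the first letter into the
rest. Up to shorter words `τ` behaves like the top-to-random shuffle: `τ(τ-1)⋯(τ-n)` shortens words
of length `n`. So `-1` is not an eigenvalue of `τ`.

Injectivity leaves the values `D(x)(σ_{x₁}⋯σ_{xₙ} 1)` on generators `x` free to be prescribed. Take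
`P` to be the free `ComMag`-algebra. If `g` inverts `symMap` in degrees at most `n`, the choice
`g(xₙ)(⋯(g(x₁) x))` forces `D(symMap m)(1) = |m| m` for every monomial `m` of degree at most `n +
1`. Induction on `n` concludes. -/

namespace PreLieSym

/-! ### The tensor module of a pre-Lie algebra -/

section TensorModule

variable {K : Type u} [Field K] {L : Type v} [NonUnitalNonAssocRing L] [Module K L]
  {B : Type w} (b : Module.Basis B K L)

/-- Linear maps on the span of words agree if they agree on the words. -/
theorem word_hom_ext {P : Type*} [AddCommGroup P] [Module K P] {f g : (List B →₀ K) →ₗ[K] P}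
    (h : ∀ l, f (Finsupp.single l 1) = g (Finsupp.single l 1)) : f = g :=
  Finsupp.lhom_ext' fun l => LinearMap.ext_ring (h l)

/-- Prepending an element of `L` to a word in the basis of `L`. -/
noncomputable def consOp : L →ₗ[K] Module.End K (List B →₀ K) :=
  b.constr K (fun i => Finsupp.lmapDomain K K (List.cons i))

theorem consOp_basis (i : B) (l : List B) (k : K) :
    consOp b (b i) (Finsupp.single l k) = Finsupp.single (i :: l) k := by
  rw [consOp, Module.Basis.constr_basis, Finsupp.lmapDomain_apply, Finsupp.mapDomain_single]

variable [IsScalarTower K L L] [SMulCommClass K L L]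

/-- The insertion of an element of `L` into a word, as a function of the element. -/
noncomputable def insertWord : List B → L →ₗ[K] (List B →₀ K)
  | [] => (consOp b).flip (Finsupp.single [] 1)
  | i :: l => consOp b (b i) ∘ₗ insertWord l -
      (consOp b).flip (Finsupp.single l 1) ∘ₗ LinearMap.mul K L (b i) +
      (consOp b).flip (Finsupp.single (i :: l) 1)

/-- The insertion of an element of `L` into words: a deformation of the shuffle product by
a letter. -/
noncomputable def insertOp : L →ₗ[K] Module.End K (List B →₀ K) :=
  (Finsupp.linearCombination K (insertWord b)).flip

theorem insertOp_word (y : L) (l : List B) :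
    insertOp b y (Finsupp.single l 1) = insertWord b l y := by
  simp [insertOp]

theorem insertOp_nil (y : L) :
    insertOp b y (Finsupp.single [] 1) = consOp b y (Finsupp.single [] 1) := by
  rw [insertOp_word]; rfl

theorem insertOp_consOp (y x : L) (u : List B →₀ K) :
    insertOp b y (consOp b x u) =
      consOp b x (insertOp b y u) - consOp b (x * y) u + consOp b y (consOp b x u) := by
  have h1 : ∀ i, insertOp b y ∘ₗ consOp b (b i) = consOp b (b i) ∘ₗ insertOp b y -
      consOp b (b i * y) + consOp b y ∘ₗ consOp b (b i) := by
    intro i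
    refine word_hom_ext fun l => ?_
    simp only [LinearMap.comp_apply, LinearMap.add_apply, LinearMap.sub_apply, consOp_basis,
      insertOp_word]
    rfl
  have h2 : insertOp b y ∘ₗ (consOp b).flip u = (consOp b).flip (insertOp b y u) -
      (consOp b).flip u ∘ₗ (LinearMap.mul K L).flip y + consOp b y ∘ₗ (consOp b).flip u :=
    b.ext fun i => LinearMap.congr_fun (h1 i) u
  exact LinearMap.congr_fun h2 x

/-- Induction on the word. After a letter `x` is prepended, the terms outside the inductive
hypothesis match because the right multiplications of a pre-Lie algebra satisfy `x(yz - zy) = (xy)z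
- (xz)y`, which is the only use of `hL`. -/
theorem insertOp_commutator (hL : ∀ x y z : L, associator x y z = associator x z y) (y z : L)
    (u : List B →₀ K) :
    insertOp b y (insertOp b z u) - insertOp b z (insertOp b y u) =
      insertOp b (y * z - z * y) u := by
  have h : insertOp b y ∘ₗ insertOp b z - insertOp b z ∘ₗ insertOp b y =
      insertOp b (y * z - z * y) := by
    refine word_hom_ext fun l => ?_
    induction l with
    | nil =>
      simp only [LinearMap.comp_apply, LinearMap.sub_apply, insertOp_nil, insertOp_consOp,
        map_sub]
      abel
    | cons i l ih =>
      have hi := hL (b i) y z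
      simp only [associator_apply] at hi
      have hi' : b i * (y * z - z * y) = (b i * y) * z - (b i * z) * y := by
        rw [mul_sub]
        linear_combination (norm := abel) hi.symm
      rw [← consOp_basis b i l 1]
      simp only [LinearMap.comp_apply, LinearMap.sub_apply] at ih ⊢
      rw [insertOp_consOp b (y * z - z * y), ← ih, hi']
      simp only [insertOp_consOp, map_sub, map_add, LinearMap.sub_apply]
      abel
  exact LinearMap.congr_fun h u

end TensorModule

/-! ### Split extensions of pre-Lie algebras -/

/-- The product `L × Hom(M, P)`, on which a pair of actions of `L` on `M` induces a product. -/
def SplitExt {K : Type*} [Field K] {L M : Type*} [AddCommGroup L] [Module K L] [AddCommGroup M]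
    [Module K M] (_lam _rho : L →ₗ[K] Module.End K M) (P : Type*) [AddCommGroup P] [Module K P] :
    Type _ :=
  L × (M →ₗ[K] P)

namespace SplitExt

variable {K : Type*} [Field K] {L M : Type*} [NonUnitalNonAssocRing L] [Module K L]
  [AddCommGroup M] [Module K M] (lam rho : L →ₗ[K] Module.End K M) (P : Type*) [AddCommGroup P]
  [Module K P]

instance instAddCommGroup : AddCommGroup (SplitExt lam rho P) :=
  inferInstanceAs (AddCommGroup (L × (M →ₗ[K] P)))

instance : Module K (SplitExt lam rho P) :=
  inferInstanceAs (Module K (L × (M →ₗ[K] P)))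

instance instMul : Mul (SplitExt lam rho P) where
  mul a c := (a.1 * c.1, c.2 ∘ₗ lam a.1 + a.2 ∘ₗ rho c.1)

variable {lam rho P}

theorem ext {a c : SplitExt lam rho P} (h1 : a.1 = c.1) (h2 : ∀ m, a.2 m = c.2 m) : a = c :=
  Prod.ext h1 (LinearMap.ext h2)

theorem fst_mul (a c : SplitExt lam rho P) : (a * c).1 = a.1 * c.1 := rfl

theorem snd_mul (a c : SplitExt lam rho P) (m : M) :
    (a * c).2 m = c.2 (lam a.1 m) + a.2 (rho c.1 m) := rfl

theorem fst_add (a c : SplitExt lam rho P) : (a + c).1 = a.1 + c.1 := rfl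

theorem snd_add (a c : SplitExt lam rho P) (m : M) : (a + c).2 m = a.2 m + c.2 m := rfl

theorem snd_sub (a c : SplitExt lam rho P) (m : M) : (a - c).2 m = a.2 m - c.2 m := rfl

theorem fst_smul (k : K) (a : SplitExt lam rho P) : (k • a).1 = k • a.1 := rfl

theorem snd_smul (k : K) (a : SplitExt lam rho P) (m : M) : (k • a).2 m = k • a.2 m := rfl

theorem fst_zero : (0 : SplitExt lam rho P).1 = 0 := rfl

theorem snd_zero (m : M) : (0 : SplitExt lam rho P).2 m = 0 := rfl

instance : NonUnitalNonAssocRing (SplitExt lam rho P) where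
  __ := instAddCommGroup lam rho P
  __ := instMul lam rho P
  left_distrib a c d := by
    refine ext ?_ fun m => ?_
    · simp only [fst_mul, fst_add, mul_add]
    · simp only [snd_mul, fst_add, snd_add, map_add, LinearMap.add_apply]; abel
  right_distrib a c d := by
    refine ext ?_ fun m => ?_
    · simp only [fst_mul, fst_add, add_mul]
    · simp only [snd_mul, fst_add, snd_add, map_add, LinearMap.add_apply]; abel
  zero_mul a := by
    refine ext ?_ fun m => ?_
    · simp only [fst_mul, fst_zero, zero_mul]
    · simp only [snd_mul, fst_zero, snd_zero, map_zero, LinearMap.zero_apply, add_zero]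
  mul_zero a := by
    refine ext ?_ fun m => ?_
    · simp only [fst_mul, fst_zero, mul_zero]
    · simp only [snd_mul, fst_zero, snd_zero, map_zero, LinearMap.zero_apply, add_zero]

instance [IsScalarTower K L L] : IsScalarTower K (SplitExt lam rho P) (SplitExt lam rho P) where
  smul_assoc k a c := by
    refine ext ?_ fun m => ?_
    · simp only [smul_eq_mul, fst_mul, fst_smul, smul_mul_assoc]
    · simp only [smul_eq_mul, snd_mul, fst_smul, snd_smul, map_smul, LinearMap.smul_apply,
        smul_add]

instance [SMulCommClass K L L] : SMulCommClass K (SplitExt lam rho P) (SplitExt lam rho P) where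
  smul_comm k a c := by
    refine ext ?_ fun m => ?_
    · simp only [smul_eq_mul, fst_mul, fst_smul, mul_smul_comm]
    · simp only [smul_eq_mul, snd_mul, fst_smul, snd_smul, map_smul, LinearMap.smul_apply,
        smul_add]

/-- In the `Hom` component of the pre-Lie identity for `a, c, d`, the terms in `c.2` and those in
`d.2` cancel by `hlr`, and the terms in `a.2` cancel by `hrr`. The compositions are reversed because
`L` acts on the source of `Hom(M, P)`. -/
theorem satisfies_preLieIds [IsScalarTower K L L] [SMulCommClass K L L]
    (hL : ∀ x y z : L, associator x y z = associator x z y)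
    (hlr : ∀ x y m, rho y (lam x m) = lam x (rho y m) - lam (x * y) m + lam y (lam x m))
    (hrr : ∀ y z m, rho y (rho z m) - rho z (rho y m) = rho (y * z - z * y) m) :
    Satisfies (preLieIds K) (SplitExt lam rho P) := by
  refine satisfies_preLieIds_iff.2 fun a c d => ?_
  refine ext (hL a.1 c.1 d.1) fun m => ?_
  have h := congrArg a.2 (hrr c.1 d.1 m)
  simp only [map_sub, LinearMap.sub_apply] at h
  simp only [associator_apply, snd_sub, snd_mul, fst_mul, hlr, map_add, map_sub]
  linear_combination (norm := abel) h

end SplitExt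

/-! ### Words filtered by length -/

section Injectivity

variable {K : Type u} [Field K] {L : Type v} [NonUnitalNonAssocRing L] [Module K L]
  {B : Type w} (b : Module.Basis B K L)

/-- The span of the words of length less than `n`. -/
def shortWords (K : Type u) [Field K] (B : Type w) (n : ℕ) : Submodule K (List B →₀ K) :=
  Finsupp.supported K K {l | l.length < n}

theorem single_mem_shortWords {n : ℕ} {l : List B} (h : l.length < n) (k : K) :
    Finsupp.single l k ∈ shortWords K B n :=
  Finsupp.single_mem_supported K k h

theorem shortWords_mono {m n : ℕ} (h : m ≤ n) : shortWords K B m ≤ shortWords K B n :=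
  Finsupp.supported_mono fun _ hl => lt_of_lt_of_le hl h

theorem shortWords_zero : shortWords K B 0 = ⊥ := by
  simp [shortWords]

theorem exists_mem_shortWords (u : List B →₀ K) : ∃ n, u ∈ shortWords K B n := by
  refine ⟨u.support.sup List.length + 1, (Finsupp.mem_supported K u).2 fun l hl => ?_⟩
  exact Nat.lt_succ_of_le (Finset.le_sup (f := List.length) hl)

/-- A linear map sends short words into a submodule if it does so on each word. -/
theorem map_mem_of_words {P : Type*} [AddCommGroup P] [Module K P] {f : (List B →₀ K) →ₗ[K] P}
    {n : ℕ} {S : Submodule K P} (h : ∀ l, l.length < n → f (Finsupp.single l 1) ∈ S)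
    {u : List B →₀ K} (hu : u ∈ shortWords K B n) : f u ∈ S := by
  have hle : shortWords K B n ≤ S.comap f := by
    rw [shortWords, Finsupp.supported_eq_span_single, Submodule.span_le]
    rintro _ ⟨l, hl, rfl⟩
    exact h l hl
  exact hle hu

theorem consOp_mem (y : L) {n : ℕ} {u : List B →₀ K} (hu : u ∈ shortWords K B n) :
    consOp b y u ∈ shortWords K B (n + 1) := by
  have : ⊤ ≤ (shortWords K B (n + 1)).comap ((consOp b).flip u) := by
    rw [← b.span_eq, Submodule.span_le]
    rintro _ ⟨i, rfl⟩
    change consOp b (b i) u ∈ shortWords K B (n + 1)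
    refine map_mem_of_words (fun l hl => ?_) hu
    rw [consOp_basis]
    exact single_mem_shortWords (by simpa using hl) 1
  exact this (Submodule.mem_top (x := y))

/-- Two linear maps on words agree if they agree on the empty word and after prepending any
element of the basis. -/
theorem cons_hom_ext {P : Type*} [AddCommGroup P] [Module K P] {f g : (List B →₀ K) →ₗ[K] P}
    (h0 : f (Finsupp.single [] 1) = g (Finsupp.single [] 1))
    (h : ∀ i u, f (consOp b (b i) u) = g (consOp b (b i) u)) : f = g := by
  refine word_hom_ext fun l => ?_
  cases l with
  | nil => exact h0
  | cons i l => simpa only [consOp_basis] using h i (Finsupp.single l 1)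

/-- The linear map on words with given value at the empty word, and given composites with the
prependings of the elements of the basis. -/
noncomputable def consRec {P : Type*} [AddCommGroup P] [Module K P] (p : P)
    (F : L →ₗ[K] (List B →₀ K) →ₗ[K] P) : (List B →₀ K) →ₗ[K] P :=
  Finsupp.linearCombination K fun l => match l with
    | [] => p
    | i :: l => F (b i) (Finsupp.single l 1)

theorem consRec_nil {P : Type*} [AddCommGroup P] [Module K P] (p : P)
    (F : L →ₗ[K] (List B →₀ K) →ₗ[K] P) : consRec b p F (Finsupp.single [] 1) = p := by
  simp [consRec]

theorem consRec_consOp {P : Type*} [AddCommGroup P] [Module K P] (p : P)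
    (F : L →ₗ[K] (List B →₀ K) →ₗ[K] P) (y : L) (u : List B →₀ K) :
    consRec b p F (consOp b y u) = F y u := by
  have h1 : ∀ i, consRec b p F ∘ₗ consOp b (b i) = F (b i) := by
    intro i
    refine word_hom_ext fun l => ?_
    simp [consOp_basis, consRec]
  have h2 : consRec b p F ∘ₗ (consOp b).flip u = F.flip u :=
    b.ext fun i => LinearMap.congr_fun (h1 i) u
  exact LinearMap.congr_fun h2 y

/-- The linear map sending a word to the iterated action of its letters on a vector. -/
noncomputable def foldWords {P : Type*} [AddCommGroup P] [Module K P] (p : P)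
    (F : L →ₗ[K] Module.End K P) : (List B →₀ K) →ₗ[K] P :=
  Finsupp.linearCombination K fun l => l.foldr (fun i q => F (b i) q) p

theorem foldWords_nil {P : Type*} [AddCommGroup P] [Module K P] (p : P)
    (F : L →ₗ[K] Module.End K P) : foldWords b p F (Finsupp.single [] 1) = p := by
  simp [foldWords]

theorem foldWords_consOp {P : Type*} [AddCommGroup P] [Module K P] (p : P)
    (F : L →ₗ[K] Module.End K P) (y : L) (u : List B →₀ K) :
    foldWords b p F (consOp b y u) = F y (foldWords b p F u) := by
  have h1 : ∀ i, foldWords b p F ∘ₗ consOp b (b i) = F (b i) ∘ₗ foldWords b p F := by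
    intro i
    refine word_hom_ext fun l => ?_
    simp [consOp_basis, foldWords]
  have h2 : foldWords b p F ∘ₗ (consOp b).flip u = F.flip (foldWords b p F u) :=
    b.ext fun i => LinearMap.congr_fun (h1 i) u
  exact LinearMap.congr_fun h2 y

/-- Deleting the first letter of the words that start with `i`. -/
noncomputable def uncons (i : B) : Module.End K (List B →₀ K) :=
  Finsupp.lcomapDomain (List.cons i) (List.cons_injective)

theorem uncons_apply (i : B) (u : List B →₀ K) (l : List B) : uncons i u l = u (i :: l) := rfl

theorem uncons_mem (i : B) {n : ℕ} {u : List B →₀ K} (hu : u ∈ shortWords K B (n + 1)) :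
    uncons i u ∈ shortWords K B n := by
  refine (Finsupp.mem_supported' K _).2 fun l hl => ?_
  rw [uncons_apply]
  refine (Finsupp.mem_supported' K u).1 hu _ fun h => hl ?_
  simpa using h

/-! ### The first-letter insertion operator and its spectrum -/

variable [IsScalarTower K L L] [SMulCommClass K L L]

theorem insertOp_mem (y : L) {n : ℕ} {u : List B →₀ K} (hu : u ∈ shortWords K B n) :
    insertOp b y u ∈ shortWords K B (n + 1) := by
  refine map_mem_of_words (fun l hl => ?_) hu
  clear hu
  induction l generalizing n with
  | nil =>
    rw [insertOp_nil]
    exact consOp_mem b y (single_mem_shortWords hl 1)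
  | cons i l ih =>
    obtain ⟨n, rfl⟩ : ∃ m, n = m + 1 := ⟨n - 1, by simp at hl; omega⟩
    have hl' : l.length < n := by simpa using hl
    have hs := single_mem_shortWords hl' (1 : K)
    rw [← consOp_basis b, insertOp_consOp]
    exact add_mem (sub_mem (consOp_mem b _ (ih hl'))
      (shortWords_mono (Nat.le_succ _) (consOp_mem b _ hs)))
      (consOp_mem b _ (consOp_mem b _ hs))

/-- The operator inserting the first letter into the rest of the word. -/
noncomputable def shuffleFirst : Module.End K (List B →₀ K) := consRec b 0 (insertOp b)

theorem shuffleFirst_nil : shuffleFirst b (Finsupp.single [] 1) = 0 := consRec_nil b _ _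

theorem shuffleFirst_consOp (y : L) (u : List B →₀ K) :
    shuffleFirst b (consOp b y u) = insertOp b y u := consRec_consOp b _ _ y u

theorem shuffleFirst_mem {n : ℕ} {u : List B →₀ K} (hu : u ∈ shortWords K B n) :
    shuffleFirst b u ∈ shortWords K B n := by
  refine map_mem_of_words (fun l hl => ?_) hu
  cases l with
  | nil => rw [shuffleFirst_nil]; exact zero_mem _
  | cons i l =>
    obtain ⟨n, rfl⟩ : ∃ m, n = m + 1 := ⟨n - 1, by simp at hl; omega⟩
    rw [← consOp_basis b, shuffleFirst_consOp]
    exact insertOp_mem b _ (single_mem_shortWords (by simpa using hl) 1)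

/-- With `τ = shuffleFirst b` and `r = insertOp b`, this is `[τ, r_y] = r_y` up to lower length. On
`x l` the error is `[r_x, r_y] l - r_{x*y} l = -r_{y*x} l`, one letter shorter than `r_y (x l)` at
the top. -/
theorem shuffleFirst_insertOp_sub_mem
    (hL : ∀ x y z : L, associator x y z = associator x z y) (y : L) {n : ℕ} {u : List B →₀ K}
    (hu : u ∈ shortWords K B n) :
    shuffleFirst b (insertOp b y u) - insertOp b y (shuffleFirst b u) - insertOp b y u ∈
      shortWords K B n := by
  refine map_mem_of_words (f := shuffleFirst b ∘ₗ insertOp b y - insertOp b y ∘ₗ shuffleFirst b -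
    insertOp b y) (fun l hl => ?_) hu
  simp only [LinearMap.sub_apply, LinearMap.comp_apply]
  cases l with
  | nil =>
    rw [shuffleFirst_nil, insertOp_nil, shuffleFirst_consOp, insertOp_nil, map_zero, sub_zero,
      sub_self]
    exact zero_mem _
  | cons i l =>
    obtain ⟨n, rfl⟩ : ∃ m, n = m + 1 := ⟨n - 1, by simp at hl; omega⟩
    have h := insertOp_commutator b hL (b i) y (Finsupp.single l 1)
    have : shuffleFirst b (insertOp b y (Finsupp.single (i :: l) 1)) -
        insertOp b y (shuffleFirst b (Finsupp.single (i :: l) 1)) -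
        insertOp b y (Finsupp.single (i :: l) 1) = -insertOp b (y * b i) (Finsupp.single l 1) := by
      rw [← consOp_basis b i l 1]
      simp only [shuffleFirst_consOp, insertOp_consOp, map_add, map_sub, LinearMap.sub_apply]
        at h ⊢
      linear_combination (norm := abel) h
    rw [this]
    exact neg_mem (insertOp_mem b _ (single_mem_shortWords (by simpa using hl) 1))

/-- The operator inserting successively the letters of a word. -/
noncomputable def insertList : List B → Module.End K (List B →₀ K)
  | [] => LinearMap.id
  | i :: l => insertOp b (b i) ∘ₗ insertList l

theorem insertList_append (l : List B) (i : B) (u : List B →₀ K) :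
    insertList b (l ++ [i]) u = insertList b l (insertOp b (b i) u) := by
  induction l with
  | nil => rfl
  | cons j l ih => exact congrArg (insertOp b (b j)) ih

theorem insertList_mem (l : List B) {n : ℕ} {u : List B →₀ K} (hu : u ∈ shortWords K B n) :
    insertList b l u ∈ shortWords K B (n + l.length) := by
  induction l with
  | nil => exact hu
  | cons i l ih => exact insertOp_mem b (b i) ih

/-- Each insertion moved past `shuffleFirst` contributes one copy of itself, up to lower length;
hence the scalar `l.length`. -/
theorem shuffleFirst_insertList_sub_mem
    (hL : ∀ x y z : L, associator x y z = associator x z y) (l : List B) {n : ℕ}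
    {u : List B →₀ K} (hu : u ∈ shortWords K B (n + 1)) :
    shuffleFirst b (insertList b l u) - insertList b l (shuffleFirst b u) -
      (l.length : K) • insertList b l u ∈ shortWords K B (n + l.length) := by
  induction l with
  | nil => simp [insertList]
  | cons i l ih =>
    have h1 := shuffleFirst_insertOp_sub_mem b hL (b i) (insertList_mem b l hu)
    have h2 := insertOp_mem b (b i) ih
    have h3 : n + 1 + l.length = n + (i :: l).length := by simp; omega
    rw [h3] at h1
    have h4 := add_mem h1 h2
    convert h4 using 1
    simp only [insertList, LinearMap.comp_apply, map_sub, map_smul, List.length_cons,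
      Nat.cast_add, Nat.cast_one, add_smul, one_smul]
    abel

/-- The falling factorials of the operator `shuffleFirst`. -/
noncomputable def fallingOp : ℕ → Module.End K (List B →₀ K)
  | 0 => LinearMap.id
  | k + 1 => (shuffleFirst b - (k : K) • LinearMap.id) ∘ₗ fallingOp k

theorem fallingOp_succ (k : ℕ) (u : List B →₀ K) :
    fallingOp b (k + 1) u = shuffleFirst b (fallingOp b k u) - (k : K) • fallingOp b k u := rfl

theorem fallingOp_mem (k : ℕ) {n : ℕ} {u : List B →₀ K} (hu : u ∈ shortWords K B n) :
    fallingOp b k u ∈ shortWords K B n := by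
  induction k with
  | zero => exact hu
  | succ k ih =>
    rw [fallingOp_succ]
    exact sub_mem (shuffleFirst_mem b ih) (Submodule.smul_mem _ _ ih)

/-- The factor `τ - k` with `k = l.length` is designed to cancel the scalar in
`shuffleFirst_insertList_sub_mem`, so that only `τ` acting on `v` survives. -/
theorem fallingOp_succ_sub_mem (hL : ∀ x y z : L, associator x y z = associator x z y)
    {l : List B} {n m : ℕ} {u v : List B →₀ K} (hm : m = n + l.length)
    (hv : v ∈ shortWords K B (n + 1)) (h : fallingOp b l.length u - insertList b l v ∈
      shortWords K B m) :
    fallingOp b (l.length + 1) u - insertList b l (shuffleFirst b v) ∈ shortWords K B m := by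
  have h1 := shuffleFirst_insertList_sub_mem b hL l hv
  rw [← hm] at h1
  have h2 := add_mem h1 (sub_mem (shuffleFirst_mem b h) (Submodule.smul_mem _ (l.length : K) h))
  convert h2 using 1
  rw [fallingOp_succ, map_sub, smul_sub]
  abel

theorem fallingOp_length_sub_mem (hL : ∀ x y z : L, associator x y z = associator x z y)
    (l w : List B) :
    fallingOp b l.length (Finsupp.single (l ++ w) 1) - insertList b l (Finsupp.single w 1) ∈
      shortWords K B (w.length + l.length) := by
  -- The last letter of `l` is handed over to the front of `w`, where the next factor of the falling
  -- factorial inserts it.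
  induction l using List.reverseRecOn generalizing w with
  | nil => simp [fallingOp, insertList]
  | append_singleton l i ih =>
    have h := fallingOp_succ_sub_mem b hL (n := w.length + 1) rfl
      (single_mem_shortWords (by simp) 1) (ih (i :: w))
    rw [← consOp_basis b i w, shuffleFirst_consOp, ← insertList_append] at h
    simp only [List.length_append, List.length_singleton, List.append_assoc, List.singleton_append]
    rwa [← add_assoc, add_right_comm]

theorem fallingOp_mem_of_mem_succ (hL : ∀ x y z : L, associator x y z = associator x z y) {n : ℕ}
    {u : List B →₀ K} (hu : u ∈ shortWords K B (n + 1)) :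
    fallingOp b (n + 1) u ∈ shortWords K B n := by
  refine map_mem_of_words (fun l hl => ?_) hu
  rcases (Nat.lt_succ_iff.1 hl).lt_or_eq with h | rfl
  · exact fallingOp_mem b _ (single_mem_shortWords h 1)
  · have h1 := fallingOp_length_sub_mem b hL l []
    -- All letters have been inserted into the empty word; the extra factor applies `shuffleFirst`
    -- to that empty word, giving zero.
    have h := fallingOp_succ_sub_mem b hL (n := 0) (by simp)
      (single_mem_shortWords (by simp) 1) h1
    rw [shuffleFirst_nil, map_zero, sub_zero] at h
    simpa using h

/-- The scalar is the falling factorial of `-1`, the product `(-1)(-2)⋯(-k)`. -/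
theorem fallingOp_eq_of_eigenvector {u : List B →₀ K} (hu : shuffleFirst b u = -u) (k : ℕ) :
    fallingOp b k u = ((-1) ^ k * (k.factorial : K)) • u := by
  induction k with
  | zero => simp [fallingOp]
  | succ k ih =>
    rw [fallingOp_succ, ih, map_smul, hu, Nat.factorial_succ]
    push_cast
    module

/-- The falling factorial lowers the length of `u` but only rescales it by a nonzero number, so `u`
lies in every step of the filtration. -/
theorem eq_zero_of_shuffleFirst_eq_neg [CharZero K]
    (hL : ∀ x y z : L, associator x y z = associator x z y) {u : List B →₀ K}
    (hu : shuffleFirst b u = -u) : u = 0 := by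
  obtain ⟨n, hn⟩ := exists_mem_shortWords u
  induction n with
  | zero => simpa [shortWords_zero] using hn
  | succ n ih =>
    refine ih ?_
    have h := fallingOp_mem_of_mem_succ b hL hn
    rw [fallingOp_eq_of_eigenvector b hu] at h
    refine (Submodule.smul_mem_iff _ ?_).1 h
    exact mul_ne_zero (pow_ne_zero _ (neg_ne_zero.2 one_ne_zero))
      (Nat.cast_ne_zero.2 (Nat.factorial_ne_zero _))

/-! ### Iterated symmetrized multiplications of the empty word -/

/-- The action of the symmetrized multiplications on words. -/
noncomputable def symOp : L →ₗ[K] Module.End K (List B →₀ K) := consOp b + insertOp b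

theorem symOp_apply (y : L) (u : List B →₀ K) :
    symOp b y u = consOp b y u + insertOp b y u := rfl

/-- The linear map sending a word to the iterated action of its letters on the empty word. -/
noncomputable def symWords : Module.End K (List B →₀ K) :=
  foldWords b (Finsupp.single [] 1) (symOp b)

theorem symWords_nil : symWords b (Finsupp.single [] 1) = Finsupp.single [] 1 :=
  foldWords_nil b _ _

theorem symWords_consOp (y : L) (u : List B →₀ K) :
    symWords b (consOp b y u) = symOp b y (symWords b u) :=
  foldWords_consOp b _ _ y u

/-- The preimage of `symWords` under `1 + shuffleFirst`. -/
noncomputable def preSymWords : Module.End K (List B →₀ K) :=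
  consRec b (Finsupp.single [] 1)
    ((LinearMap.llcomp K _ _ _).flip (symWords b) ∘ₗ consOp b)

theorem preSymWords_consOp (y : L) (u : List B →₀ K) :
    preSymWords b (consOp b y u) = consOp b y (symWords b u) := consRec_consOp b _ _ y u

theorem preSymWords_add_shuffleFirst (u : List B →₀ K) :
    preSymWords b u + shuffleFirst b (preSymWords b u) = symWords b u := by
  have : preSymWords b + shuffleFirst b ∘ₗ preSymWords b = symWords b := by
    refine cons_hom_ext b ?_ fun i u => ?_
    · simp only [LinearMap.add_apply, LinearMap.comp_apply, preSymWords, consRec_nil,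
        shuffleFirst_nil, symWords_nil, add_zero]
    · simp only [LinearMap.add_apply, LinearMap.comp_apply, preSymWords_consOp,
        shuffleFirst_consOp, symWords_consOp, symOp_apply]
  exact LinearMap.congr_fun this u

theorem preSymWords_apply_nil (u : List B →₀ K) : preSymWords b u [] = u [] := by
  have : Finsupp.lapply [] ∘ₗ preSymWords b = Finsupp.lapply [] := by
    refine cons_hom_ext b ?_ fun i u => ?_
    · simp [preSymWords, consRec_nil]
    · have h : ∀ v : List B →₀ K, consOp b (b i) v [] = 0 := fun v => by
        rw [consOp, Module.Basis.constr_basis, Finsupp.lmapDomain_apply]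
        exact Finsupp.mapDomain_of_notMem_range _ _ (by simp)
      simp [preSymWords_consOp, h]
  exact LinearMap.congr_fun this u

/-- `preSymWords` keeps the first letter and applies `symWords` to the rest; this is what lets
injectivity of `symWords` descend to shorter words. -/
theorem uncons_preSymWords (j : B) (u : List B →₀ K) :
    uncons j (preSymWords b u) = symWords b (uncons j u) := by
  classical
  have h : ∀ i (v : List B →₀ K), uncons j (consOp b (b i) v) = if i = j then v else 0 := by
    intro i v
    ext l
    rw [uncons_apply, consOp, Module.Basis.constr_basis, Finsupp.lmapDomain_apply]
    split_ifs with hij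
    · rw [hij, Finsupp.mapDomain_apply List.cons_injective]
    · exact Finsupp.mapDomain_of_notMem_range _ _ (by simp [hij])
  have : uncons j ∘ₗ preSymWords b = symWords b ∘ₗ uncons j := by
    refine cons_hom_ext b ?_ fun i u => ?_
    · have h' : uncons j (Finsupp.single ([] : List B) (1 : K)) = 0 := by
        ext l
        simp [uncons_apply]
      simp [preSymWords, consRec_nil, h']
    · simp only [LinearMap.comp_apply, preSymWords_consOp, h]
      split_ifs <;> simp
  exact LinearMap.congr_fun this u

theorem symWords_injective [CharZero K] (hL : ∀ x y z : L, associator x y z = associator x z y) :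
    Function.Injective (symWords b) := by
  refine (injective_iff_map_eq_zero _).2 fun u hu => ?_
  obtain ⟨n, hn⟩ := exists_mem_shortWords u
  induction n generalizing u with
  | zero => simpa [shortWords_zero] using hn
  | succ n ih =>
    -- `symWords` factors as `1 + shuffleFirst` after `preSymWords`, and `1 + shuffleFirst` has
    -- trivial kernel.
    have h0 : preSymWords b u = 0 := by
      refine eq_zero_of_shuffleFirst_eq_neg b hL ?_
      rw [eq_neg_iff_add_eq_zero, add_comm, preSymWords_add_shuffleFirst, hu]
    ext l
    cases l with
    | nil => rw [← preSymWords_apply_nil b, h0]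
    | cons i l =>
      have h1 : uncons i u = 0 :=
        ih _ (by rw [← uncons_preSymWords, h0, map_zero]) (uncons_mem i hn)
      rw [← uncons_apply, h1]
      rfl

end Injectivity

/-! ### Recovering the degree operator from a derivation -/

section SymmetrizedProduct

variable {K : Type u} [Field K] {X : Type v}

/-- The span of the monomials of degree at most `n` in the free commutative magmatic algebra. -/
noncomputable def lowDegree (K : Type u) [Field K] (X : Type v) (n : ℕ) :
    Submodule K (FreeComMag K X) :=
  Submodule.span K (mon (comIds K) '' {m | m.length ≤ n})

theorem mon_mem_lowDegree {m : FreeMagma X} {n : ℕ} (h : m.length ≤ n) :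
    mon (comIds K) m ∈ lowDegree K X n :=
  Submodule.subset_span ⟨m, h, rfl⟩

theorem mk_single (m : FreeMagma X) :
    FreeAlg.mk (comIds K) X (MonoidAlgebra.single m 1) = mon (comIds K) m := by
  induction m with
  | ih1 x => rfl
  | ih2 m n ihm ihn =>
    rw [mon_mul, ← ihm, ← ihn, ← FreeAlg.mk_mul, MonoidAlgebra.single_mul_single, one_mul]

theorem exists_mk_mem_lowDegree (a : FreeNonUnitalNonAssocAlgebra K X) :
    ∃ n, FreeAlg.mk (comIds K) X a ∈ lowDegree K X n := by
  refine MonoidAlgebra.induction_linear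
    (motive := fun a => ∃ n, FreeAlg.mk (comIds K) X a ∈ lowDegree K X n) a
    ⟨0, (LinearMap.map_zero (FreeAlg.mk (comIds K) X)).symm ▸ Submodule.zero_mem _⟩ ?_ ?_
  · rintro a c ⟨n, hn⟩ ⟨m, hm⟩
    refine ⟨max n m, ?_⟩
    have h1 : lowDegree K X n ≤ lowDegree K X (max n m) :=
      Submodule.span_mono (Set.image_mono fun _ h => le_trans h (le_max_left n m))
    have h2 : lowDegree K X m ≤ lowDegree K X (max n m) :=
      Submodule.span_mono (Set.image_mono fun _ h => le_trans h (le_max_right n m))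
    exact (LinearMap.map_add (FreeAlg.mk (comIds K) X) a c).symm ▸
      Submodule.add_mem _ (h1 hn) (h2 hm)
  · intro m k
    refine ⟨m.length, ?_⟩
    have : (MonoidAlgebra.single m k : FreeNonUnitalNonAssocAlgebra K X) =
        k • MonoidAlgebra.single m 1 := by
      rw [MonoidAlgebra.smul_single, smul_eq_mul, mul_one]
    rw [this, LinearMap.map_smul, mk_single]
    exact Submodule.smul_mem _ k (mon_mem_lowDegree le_rfl)

theorem exists_mem_lowDegree (a : FreeComMag K X) : ∃ n, a ∈ lowDegree K X n := by
  obtain ⟨a, rfl⟩ := FreeAlg.mk_surjective _ _ a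
  exact exists_mk_mem_lowDegree a

theorem aeval_apply_of_apply_eq_smul {V : Type*} [AddCommGroup V] [Module K V]
    {f : Module.End K V} {c : K} {x : V} (h : f x = c • x) (p : Polynomial K) :
    Polynomial.aeval f p x = p.eval c • x := by
  by_cases hx : x = 0
  · rw [hx, map_zero, smul_zero]
  · exact Module.End.aeval_apply_of_hasEigenvector ⟨Module.End.mem_eigenspace_iff.2 h, hx⟩

/-- A linear map that scales each monomial by its degree is injective. -/
theorem eq_zero_of_apply_eq_length_smul [CharZero K] {n : ℕ} (f : Module.End K (FreeComMag K X))
    (hf : ∀ m : FreeMagma X, m.length ≤ n → f (mon (comIds K) m) =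
      (m.length : K) • mon (comIds K) m)
    {a : FreeComMag K X} (ha : a ∈ lowDegree K X n) (h0 : f a = 0) : a = 0 := by
  -- `p` vanishes at every degree from 1 to `n`, so `p(f)` kills `a`; the root 0 is omitted, so
  -- `p(f)` also multiplies `a` by `p(0) ≠ 0`.
  let p : Polynomial K := ∏ i ∈ Finset.Icc 1 n, (Polynomial.X - Polynomial.C (i : K))
  have hp : lowDegree K X n ≤ LinearMap.ker (Polynomial.aeval f p) := by
    rw [lowDegree, Submodule.span_le]
    rintro _ ⟨m, hm, rfl⟩
    have h1 : Polynomial.eval (m.length : K) p = 0 := by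
      rw [Polynomial.eval_prod]
      exact Finset.prod_eq_zero (Finset.mem_Icc.2 ⟨m.length_pos, hm⟩) (by simp)
    refine LinearMap.mem_ker.2 ?_
    rw [aeval_apply_of_apply_eq_smul (hf m hm), h1, zero_smul]
  have h1 := LinearMap.mem_ker.1 (hp ha)
  rw [aeval_apply_of_apply_eq_smul (c := 0) (by rw [h0, zero_smul])] at h1
  refine (smul_eq_zero.1 h1).resolve_left ?_
  rw [Polynomial.eval_prod]
  refine Finset.prod_ne_zero_iff.2 ?_
  intro i hi
  have := (Finset.mem_Icc.1 hi).1
  simp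
  omega

/-- If the symmetrized product of a free pre-Lie algebra has no relation in degree at most `n`, then
it has none in degree at most `n + 1`. -/
theorem eq_zero_of_symMap_eq_zero [CharZero K] {n : ℕ} (g : FreePreLie K X →ₗ[K] FreeComMag K X)
    (hg : ∀ c ∈ lowDegree K X n, g (symMap K X c) = c) {a : FreeComMag K X}
    (ha : a ∈ lowDegree K X (n + 1)) (h0 : symMap K X a = 0) : a = 0 := by
  have hL := satisfies_preLieIds_iff.1 (FreeAlg.satisfies (preLieIds K) X)
  let b := Module.Basis.ofVectorSpace K (FreePreLie K X)
  obtain ⟨s, hs⟩ := (symWords b).exists_leftInverse_of_injective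
    (LinearMap.ker_eq_bot.2 (symWords_injective b hL))
  -- `F y` precomposes with left multiplication by `g y`, so in `β` the first letter of a word
  -- multiplies first.
  let F : FreePreLie K X →ₗ[K] Module.End K (Module.End K (FreeComMag K X)) :=
    (LinearMap.llcomp K _ _ _).flip ∘ₗ LinearMap.mul K (FreeComMag K X) ∘ₗ g
  let β := foldWords b LinearMap.id F
  have hβ : ∀ y u c, β (consOp b y u) c = β u (g y * c) := fun y u c =>
    LinearMap.congr_fun (foldWords_consOp b LinearMap.id F y u) c
  let A := SplitExt (consOp b) (insertOp b) (FreeComMag K X)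
  have hA : Satisfies (preLieIds K) A := SplitExt.satisfies_preLieIds hL
    (fun x y m => insertOp_consOp b y x m) (insertOp_commutator b hL)
  -- A derivation is encoded as an algebra morphism to the split extension whose first component is
  -- the identity (`hD1`). The left inverse `s` makes its value on a generator `x` at `symWords b u`
  -- equal to `β u x`.
  let D : FreePreLie K X →ₙₐ[K] A :=
    FreeAlg.lift hA fun x => (FreeAlg.of _ x, (β ∘ₗ s).flip (FreeAlg.of _ x))
  have hD_of : ∀ x, D (FreeAlg.of _ x) = (FreeAlg.of _ x, (β ∘ₗ s).flip (FreeAlg.of _ x)) :=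
    fun x => FreeAlg.lift_of hA _ x
  have hD1 : ∀ y, (D y).1 = y := by
    let π : A →ₙₐ[K] FreePreLie K X :=
      { toFun := fun a => a.1
        map_smul' := fun _ _ => rfl
        map_zero' := rfl
        map_add' := fun _ _ => rfl
        map_mul' := fun _ _ => rfl }
    have : π.comp D = NonUnitalAlgHom.id K _ :=
      FreeAlg.hom_ext fun x => congrArg Prod.fst (hD_of x)
    exact DFunLike.congr_fun this
  -- The statement for all `u` is needed because the derivation rule for `m # p` evaluates one
  -- factor at the word `u` with the other factor prepended.
  have key : ∀ m : FreeMagma X, m.length ≤ n + 1 → ∀ u,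
      (D (symMap K X (mon _ m))).2 (symWords b u) = β u ((m.length : K) • mon _ m) := by
    intro m
    induction m with
    | ih1 x =>
      intro _ u
      rw [mon_of, symMap_of, hD_of]
      change β (s (symWords b u)) _ = _
      rw [← LinearMap.comp_apply s, hs]
      simp
    | ih2 m p ihm ihp =>
      intro h u
      have hl : (m * p).length = m.length + p.length := rfl
      have hm := m.length_pos
      have hp := p.length_pos
      rw [hl] at h
      rw [mon_mul, symMap_mul, map_add, map_mul, map_mul, SplitExt.snd_add, SplitExt.snd_mul,
        SplitExt.snd_mul, hD1, hD1]
      have h1 := ihm (by omega) (consOp b (symMap K X (mon _ p)) u)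
      have h2 := ihp (by omega) (consOp b (symMap K X (mon _ m)) u)
      -- Both factors have positive degree, so each has degree at most `n` and `g` recovers it.
      rw [hβ, hg _ (mon_mem_lowDegree (by omega)), symWords_consOp, symOp_apply, map_add]
        at h1 h2
      rw [mul_smul_comm] at h1 h2
      -- Commutativity merges the two contributions into a multiple of one product, with coefficient
      -- the total degree.
      rw [mul_comm (mon (comIds K) p)] at h1
      rw [hl, Nat.cast_add, add_smul, map_add, ← h1, ← h2]
      abel
  refine eq_zero_of_apply_eq_length_smul (n := n + 1)
    { toFun := fun c => (D (symMap K X c)).2 (symWords b (Finsupp.single [] 1))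
      map_add' := fun c d => by rw [map_add, map_add, SplitExt.snd_add]
      map_smul' := fun k c => by rw [map_smul, map_smul, SplitExt.snd_smul]; rfl }
    (fun m hm => ?_) ha ?_
  · exact (key m hm _).trans (by simp only [β, foldWords_nil]; rfl)
  · change (D (symMap K X a)).2 _ = 0
    rw [h0, map_zero, SplitExt.snd_zero]

theorem symMap_injOn_lowDegree [CharZero K] (n : ℕ) {a : FreeComMag K X}
    (ha : a ∈ lowDegree K X n) (h0 : symMap K X a = 0) : a = 0 := by
  induction n generalizing a with
  | zero =>
    have : lowDegree K X 0 = ⊥ := by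
      rw [lowDegree, Submodule.span_eq_bot]
      rintro _ ⟨m, hm, rfl⟩
      exact absurd m.length_pos (by simpa using hm)
    rwa [this, Submodule.mem_bot] at ha
  | succ n ih =>
    -- Injectivity in degrees at most `n` yields a linear left inverse on that part; its behaviour
    -- elsewhere is irrelevant, and it need not respect products.
    obtain ⟨g, hg⟩ : ∃ g : FreePreLie K X →ₗ[K] FreeComMag K X,
        ∀ c ∈ lowDegree K X n, g (symMap K X c) = c := by
      obtain ⟨g, hg⟩ := ((symMap K X).domRestrict (lowDegree K X n)).exists_leftInverse_of_injective
        (LinearMap.ker_eq_bot'.2 fun c hc => Subtype.ext (ih c.2 hc))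
      exact ⟨(lowDegree K X n).subtype ∘ₗ g, fun c hc =>
        congrArg Subtype.val (LinearMap.congr_fun hg ⟨c, hc⟩)⟩
    exact eq_zero_of_symMap_eq_zero g hg ha h0

theorem symMap_injective [CharZero K] : Function.Injective (symMap K X) := by
  refine (injective_iff_map_eq_zero _).2 fun a h => ?_
  obtain ⟨n, hn⟩ := exists_mem_lowDegree a
  exact symMap_injOn_lowDegree n hn h

end SymmetrizedProduct

end PreLieSym
theorem theorem1 (K : Type u) [Field K] [CharZero K] :
    (PreLieSym.Phi K).app (Fin 2) (PreLieSym.comGen K) =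
        PreLieSym.preLieGen K +
          (PreLieSym.PreLie K).map (Equiv.swap 0 1) (PreLieSym.preLieGen K) ∧
      (∀ (S : Type) [Finite S], Function.Injective ((PreLieSym.Phi K).app S)) ∧
      (∀ X : Type v, Function.Injective (PreLieSym.symMap K X)) := by
  refine ⟨Subtype.ext ?_, fun S _ a c h => Subtype.ext ?_, fun X => PreLieSym.symMap_injective⟩
  · change PreLieSym.symMap K (Fin 2) (PreLieSym.FreeAlg.of _ 0 * PreLieSym.FreeAlg.of _ 1) =
      PreLieSym.FreeAlg.of _ 0 * PreLieSym.FreeAlg.of _ 1 +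
        PreLieSym.relabel _ (Equiv.swap 0 1)
          (PreLieSym.FreeAlg.of _ 0 * PreLieSym.FreeAlg.of _ 1)
    simp
  · exact PreLieSym.symMap_injective (congrArg Subtype.val h)
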